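/- **Setting.** Let $R$ be a reduced irreducible crystallographic (finite) root system spanning a real vector space $\mathfrak h_{\mathbb R}^*$, with coroots $\alpha^\vee$, weight lattice $P=\{\lambda\in\mathfrak h_{\mathbb R}^* : \langle\lambda,\alpha^\vee\rangle\in\mathbb Z\ \text{for all }\alpha\in R\}$ and Weyl group $W$ generated by the reflections $s_\alpha\colon\lambda\mapsto\lambda-\langle\lambda,\alpha^\vee\rangle\alpha$. Fix a choice of positive roots $R^+$, with simple roots $\alpha_1,\dots,\alpha_n$ and simple reflections $s_i=s_{\alpha_i}$, and let $\ell(w)=\#\{\alpha\in R^+ : w\alpha\notin R^+\}$. Let $\mathbb K=\mathbb Z[q,q^{-1}]$, let $\mathbb K[P]$ be the group algebra of $P$ with basis $\{x^\lambda : \lambda\in P\}$, and put $W_0(u)=\sum_{w\in W}u^{\ell(w)}$. Let $\tilde H$ be the affine Hecke algebra, with scalars extended to $\mathbb K[W_0(q^2)^{-1}]$: it is the unital associative algebra over this ring with generators $T_i$ $(1\le i\le n)$ and $x^\lambda$ $(\lambda\in P)$ and relations $$\underbrace{T_iT_jT_i\cdots}_{m_{ij}}=\underbrace{T_jT_iT_j\cdots}_{m_{ij}}\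 (i\ne j),\qquad T_i^2=(q-q^{-1})T_i+1,\qquad x^0=1,\quad x^\lambda x^\mu=x^{\lambda+\mu},$$ $$x^\lambda T_i=T_ix^{s_i\lambda}+(q-q^{-1})\frac{x^\lambda-x^{s_i\lambda}}{1-x^{-\alpha_i}},$$ where $m_{ij}$ is the order of $s_is_j$ and the quotient is taken in the group algebra of $P$. For $w\in W$ with reduced word $w=s_{i_1}\cdots s_{i_p}$ let $T_w=T_{i_1}\cdots T_{i_p}$, and let $$\mathbf 1_0=\frac1{W_0(q^2)}\sum_{w\in W}q^{\ell(w)}T_w,\qquad \varepsilon_0=\frac1{W_0(q^{-2})}\sum_{w\in W}(-q)^{-\ell(w)}T_w$$ (note that $W_0(q^{-2})$ is a power of $q$ times $W_0(q^2)$). For $\gamma\in P$ define $$m_\gamma=\sum_{\nu\in W\gamma}x^\nu,\quad a_\gamma=\sum_{w\in W}(-1)^{\ell(w)}x^{w\gamma}\ \text{ in }\mathbb K[P],\qquad M_\gamma=\mathbf 1_0x^\gamma\mathbf 1_0,\quad A_\gamma=\varepsilon_0x^\gamma\mathbf 1_0\ \text{ in }\tilde H.$$ **Proposition 2.5.** Let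 $\alpha_i$ be a simple root and let $\mu\in P$ be such that $d=\langle\mu,\alpha_i^\vee\rangle\ge0$. Then $$m_{s_i\mu}=m_\mu,\qquad a_{s_i\mu}=-a_\mu\qquad\text{and}\qquad A_{s_i\mu}=-A_\mu.$$ Let $t=q^{-2}$. If $d=0$ then $M_\mu=M_{s_i\mu}$, and if $d>0$ then $$M_{s_i\mu}=tM_\mu+\Big(\sum_{j=1}^{\lfloor (d-1)/2\rfloor}(t^2-1)t^{j-1}M_{\mu-j\alpha_i}\Big)+\begin{cases}(t-1)t^{d/2-1}M_{\mu-(d/2)\alpha_i},&\text{if }d\text{ is even},\\ 0,&\text{if }d\text{ is odd}.\end{cases}$$ -/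

import Mathlib

noncomputable section

namespace AffineHecke

variable {ι M N : Type*} [AddCommGroup M] [Module ℝ M] [AddCommGroup N] [Module ℝ N]

/-! ### The weight lattice and the Weyl group -/

section Weyl

variable (Φ : RootPairing ι ℝ M N)

/-- The weight lattice `P`: the vectors whose pairing with every coroot is an integer. -/
def weightLattice : AddSubgroup M where
  carrier := {x | ∀ i, ∃ z : ℤ, Φ.toLinearMap x (Φ.coroot i) = (z : ℝ)}
  zero_mem' := fun _ => ⟨0, by simp⟩
  add_mem' := by
    intro x y hx hy i
    obtain ⟨a, ha⟩ := hx i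
    obtain ⟨b, hb⟩ := hy i
    exact ⟨a + b, by simp [ha, hb]⟩
  neg_mem' := by
    intro x hx i
    obtain ⟨a, ha⟩ := hx i
    exact ⟨-a, by simp [ha]⟩

variable {Φ} in
/-- The integer `⟨μ, α_i^∨⟩` for a weight `μ` and a root `α_i`. -/
def weightPairing (μ : weightLattice Φ) (i : ι) : ℤ := (μ.2 i).choose

variable {Φ} in
lemma weightPairing_spec (μ : weightLattice Φ) (i : ι) :
    Φ.toLinearMap (μ : M) (Φ.coroot i) = (weightPairing μ i : ℝ) := (μ.2 i).choose_spec

/-- A root of a crystallographic root system, as an element of the weight lattice. -/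
def rootWeight [Φ.IsCrystallographic] (i : ι) : weightLattice Φ :=
  ⟨Φ.root i, fun j => ⟨Φ.pairingIn ℤ i j, by
    have h := Φ.algebraMap_pairingIn ℤ i j
    simpa using h.symm⟩⟩

variable {Φ} in
lemma smul_mem_weightLattice [Φ.IsCrystallographic] (w : Φ.weylGroup) {x : M}
    (hx : x ∈ weightLattice Φ) : w • x ∈ weightLattice Φ := by
  obtain ⟨w, hw⟩ := w
  change w • x ∈ weightLattice Φ
  induction hw using RootPairing.weylGroup.induction generalizing x with
  | mem j =>
    rw [RootPairing.Equiv.reflection_smul, RootPairing.reflection_apply]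
    refine sub_mem hx ?_
    obtain ⟨z, hz⟩ := hx j
    have h : Φ.coroot' j x = (z : ℝ) := hz
    rw [h, Int.cast_smul_eq_zsmul]
    exact zsmul_mem (rootWeight Φ j).2 z
  | one => simpa using hx
  | mul u v _ _ hu hv => rw [mul_smul]; exact hu (hv hx)

/-- The Weyl group acts on the weight lattice. -/
instance instWeylAction [Φ.IsCrystallographic] :
    DistribMulAction Φ.weylGroup (weightLattice Φ) where
  smul w μ := ⟨w • (μ : M), smul_mem_weightLattice w μ.2⟩
  one_smul μ := Subtype.ext (one_smul _ (μ : M))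
  mul_smul u v μ := Subtype.ext (mul_smul u v (μ : M))
  smul_zero w := Subtype.ext (smul_zero w)
  smul_add w μ ν := Subtype.ext (smul_add w (μ : M) (ν : M))

@[simp] lemma coe_smul [Φ.IsCrystallographic] (w : Φ.weylGroup) (μ : weightLattice Φ) :
    ((w • μ : weightLattice Φ) : M) = w • (μ : M) := rfl

/-- The reflection `s_α` in the root with index `i`, as an element of the Weyl group. -/
abbrev refl (i : ι) : Φ.weylGroup := RootPairing.weylGroup.ofIdx Φ i

variable {Φ} in
lemma refl_smul_weight [Φ.IsCrystallographic] (i : ι) (μ : weightLattice Φ) :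
    refl Φ i • μ = μ - weightPairing μ i • rootWeight Φ i := by
  apply Subtype.ext
  rw [coe_smul, RootPairing.weylGroup.ofIdx_smul, RootPairing.Equiv.reflection_smul,
    RootPairing.reflection_apply]
  have h : Φ.coroot' i (μ : M) = (weightPairing μ i : ℝ) := weightPairing_spec μ i
  rw [h, Int.cast_smul_eq_zsmul]
  rfl

lemma refl_mul_refl (i : ι) : refl Φ i * refl Φ i = 1 := by
  rw [mul_eq_one_iff_inv_eq]
  exact Subtype.ext (RootPairing.Equiv.reflection_inv Φ i)

instance instFiniteWeyl [Finite ι] [Φ.IsRootSystem] : Finite Φ.weylGroup := by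
  have hinj : Function.Injective (fun w : Φ.weylGroup => Φ.weylGroupToPerm w) := by
    intro u v huv
    apply Subtype.ext
    apply RootPairing.Equiv.weightHom_injective Φ
    apply LinearEquiv.toLinearMap_injective
    apply LinearMap.ext_on (s := Set.range Φ.root) (by simp)
    rintro _ ⟨i, rfl⟩
    change u • Φ.root i = v • Φ.root i
    rw [Φ.weylGroup_apply_root, Φ.weylGroup_apply_root]
    exact congrArg (fun e => Φ.root (e i)) huv
  exact Finite.of_injective _ hinj

instance instFintypeWeyl [Finite ι] [Φ.IsRootSystem] : Fintype Φ.weylGroup := Fintype.ofFinite _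

end Weyl

/-! ### Length and reduced words -/

section Length

variable {Φ : RootPairing ι ℝ M N} (b : Φ.Base)

/-- The length `ℓ(w)`: the number of positive roots that `w` sends to negative roots. -/
def len (w : Φ.weylGroup) : ℕ := Nat.card {i : ι // b.IsPos i ∧ ¬ b.IsPos (w • i)}

/-- The simple reflection `s_i`. -/
abbrev simpleRefl (i : b.support) : Φ.weylGroup := refl Φ i

lemma refl_mem_closure [Finite ι] [Φ.IsCrystallographic] [Φ.IsReduced] (i : ι) :
    refl Φ i ∈ Subgroup.closure (Set.range (simpleRefl b)) := by
  have key (j k : ι) : refl Φ (Φ.reflectionPerm j k) = refl Φ j * refl Φ k * refl Φ j := by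
    apply Subtype.ext
    apply RootPairing.Equiv.weightHom_injective Φ
    apply LinearEquiv.toLinearMap_injective
    ext x
    change Φ.reflection (Φ.reflectionPerm j k) x =
      Φ.reflection j (Φ.reflection k (Φ.reflection j x))
    rw [RootPairing.reflection_reflectionPerm]
    rfl
  refine b.induction_reflect i (p := fun i => refl Φ i ∈ _) ?_ ?_ ?_
  · intro i hi
    rw [key]
    exact mul_mem (mul_mem hi hi) hi
  · intro i hi
    exact Subgroup.subset_closure ⟨⟨i, hi⟩, rfl⟩
  · intro i j hi hj
    have hj' : refl Φ j ∈ Subgroup.closure (Set.range (simpleRefl b)) :=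
      Subgroup.subset_closure ⟨⟨j, hj⟩, rfl⟩
    rw [key]
    exact mul_mem (mul_mem hj' hi) hj'

lemma closure_simpleRefl [Finite ι] [Φ.IsCrystallographic] [Φ.IsReduced] :
    Subgroup.closure (Set.range (simpleRefl b)) = ⊤ := by
  rw [eq_top_iff]
  rintro ⟨w, hw⟩ -
  induction hw using RootPairing.weylGroup.induction with
  | mem i => exact refl_mem_closure b i
  | one => exact one_mem _
  | mul u v hu hv h1 h2 => exact mul_mem h1 h2

lemma exists_word [Finite ι] [Φ.IsCrystallographic] [Φ.IsReduced] (w : Φ.weylGroup) :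
    ∃ l : List b.support, (l.map (simpleRefl b)).prod = w := by
  have hw : w ∈ (Subgroup.closure (Set.range (simpleRefl b))).toSubmonoid := by
    rw [closure_simpleRefl]; trivial
  rw [Subgroup.closure_toSubmonoid] at hw
  have hs : (Set.range (simpleRefl b))⁻¹ = Set.range (simpleRefl b) := by
    ext x
    simp only [Set.mem_inv, Set.mem_range]
    refine exists_congr fun i => ?_
    have : (simpleRefl b i)⁻¹ = simpleRefl b i :=
      mul_eq_one_iff_inv_eq.mp (refl_mul_refl Φ i)
    rw [← inv_inj, inv_inv, this]
  rw [hs, Set.union_self] at hw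
  obtain ⟨l, hl, rfl⟩ := Submonoid.exists_list_of_mem_closure hw
  have hl' : l ∈ Set.range (List.map (simpleRefl b)) := by
    rw [Set.range_list_map]; exact hl
  obtain ⟨l', rfl⟩ := hl'
  exact ⟨l', rfl⟩

/-- `l` is a reduced word for `w`: a word in the simple reflections with product `w`, of minimal
length among such words. -/
def IsReducedWord (l : List b.support) (w : Φ.weylGroup) : Prop :=
  (l.map (simpleRefl b)).prod = w ∧
    ∀ l' : List b.support, (l'.map (simpleRefl b)).prod = w → l.length ≤ l'.length

lemma exists_isReducedWord [Finite ι] [Φ.IsCrystallographic] [Φ.IsReduced] (w : Φ.weylGroup) :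
    ∃ l, IsReducedWord b l w := by
  classical
  have h : ∃ n, ∃ l : List b.support, (l.map (simpleRefl b)).prod = w ∧ l.length = n := by
    obtain ⟨l, hl⟩ := exists_word b w
    exact ⟨_, l, hl, rfl⟩
  obtain ⟨l, hl, hn⟩ := Nat.find_spec h
  exact ⟨l, hl, fun l' hl' => hn ▸ Nat.find_min' h ⟨l', hl', rfl⟩⟩

/-- A chosen reduced word for `w`. -/
def reducedWord [Finite ι] [Φ.IsCrystallographic] [Φ.IsReduced] (w : Φ.weylGroup) : List b.support :=
  (exists_isReducedWord b w).choose

lemma reducedWord_spec [Finite ι] [Φ.IsCrystallographic] [Φ.IsReduced] (w : Φ.weylGroup) :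
    IsReducedWord b (reducedWord b w) w :=
  (exists_isReducedWord b w).choose_spec

/-- The Poincaré polynomial `W₀(t) = ∑_{w ∈ W} t^{ℓ(w)}`. -/
def poincare [Finite ι] [Φ.IsRootSystem] {k : Type*} [CommRing k] (t : k) : k :=
  ∑ w : Φ.weylGroup, t ^ len b w

lemma isPos_smul_simple {i j : ι} [Finite ι] [Φ.IsCrystallographic] [Φ.IsReduced]
    (hi : b.IsPos i) (hj : j ∈ b.support) (hij : i ≠ j) : b.IsPos (refl Φ j • i) :=
  hi.reflectionPerm hj hij

lemma not_isPos_smul_of_add {i j k : ι} (w : Φ.weylGroup)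
    (hk : Φ.root k = Φ.root i + Φ.root j) (hi : ¬ b.IsPos (w • i)) (hj : ¬ b.IsPos (w • j)) :
    ¬ b.IsPos (w • k) := by
  have key : Φ.root (w • k) = Φ.root (w • i) + Φ.root (w • j) := by
    have h (l : ι) : Φ.root (w • l) = w • Φ.root l := (Φ.weylGroup_apply_root w l).symm
    rw [h, h, h, hk, smul_add]
  rw [RootPairing.Base.isPos_iff'] at *
  rw [b.height_add key]
  omega

lemma isPos_smul_neg_iff (w : Φ.weylGroup) (i : ι) :
    b.IsPos (w • Φ.reflectionPerm i i) ↔ ¬ b.IsPos (w • i) := by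
  have h := RootPairing.Base.IsPos.neg_iff_not b (w • i)
  rw [← h]
  have : w • Φ.reflectionPerm i i = Φ.reflectionPerm (w • i) (w • i) := by
    apply Φ.root.injective
    have h (l : ι) : Φ.root (w • l) = w • Φ.root l := (Φ.weylGroup_apply_root w l).symm
    rw [h, RootPairing.root_reflectionPerm, RootPairing.root_reflectionPerm,
      RootPairing.reflection_apply_self, RootPairing.reflection_apply_self, h, smul_neg]
  rw [this]
  rfl

lemma len_lt_len_mul [Finite ι] [Φ.IsCrystallographic] [Φ.IsReduced] (w : Φ.weylGroup)
    {j : ι} (hj : j ∈ b.support) (h : b.IsPos (w • j)) : len b w < len b (w * refl Φ j) := by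
  let A : Set ι := {i | b.IsPos i ∧ ¬ b.IsPos (w • i)}
  let B : Set ι := {i | b.IsPos i ∧ ¬ b.IsPos ((w * refl Φ j) • i)}
  change A.ncard < B.ncard
  have hjj : refl Φ j • j = Φ.reflectionPerm j j := rfl
  have hss (i : ι) : refl Φ j • refl Φ j • i = i := by
    rw [smul_smul, refl_mul_refl, one_smul]
  have hsub : (fun i => refl Φ j • i) '' A ⊆ B := by
    rintro _ ⟨i, ⟨hi, hwi⟩, rfl⟩
    refine ⟨isPos_smul_simple b hi hj (fun h' => hwi (h' ▸ h)), ?_⟩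
    rw [mul_smul, hss]
    exact hwi
  have hjB : j ∈ B := by
    refine ⟨RootPairing.Base.isPos_of_mem_support hj, ?_⟩
    rw [mul_smul, hjj, isPos_smul_neg_iff]
    exact not_not.mpr h
  have hjA : j ∉ (fun i => refl Φ j • i) '' A := by
    rintro ⟨i, ⟨hi, -⟩, hij⟩
    have : i = Φ.reflectionPerm j j := by
      rw [← hjj, ← hss i]
      exact congrArg (fun x => refl Φ j • x) hij
    have h1 : b.IsPos ((1 : Φ.weylGroup) • Φ.reflectionPerm j j) := by
      rw [one_smul, ← this]; exact hi
    rw [isPos_smul_neg_iff, one_smul] at h1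
    exact h1 (RootPairing.Base.isPos_of_mem_support hj)
  rw [← Set.ncard_image_of_injective A (MulAction.injective (refl Φ j))]
  exact Set.ncard_lt_ncard (hsub.ssubset_of_mem_notMem hjB hjA) (Set.toFinite _)

/-- There is `w₀ ∈ W` making all positive roots negative. -/
lemma exists_longest [Finite ι] [Φ.IsRootSystem] [Φ.IsCrystallographic] [Φ.IsReduced] :
    ∃ w₀ : Φ.weylGroup, ∀ i, b.IsPos i → ¬ b.IsPos (w₀ • i) := by
  obtain ⟨w₀, hw₀⟩ := Finite.exists_max (len b)
  refine ⟨w₀, fun i hi => ?_⟩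
  refine hi.induction_on_add (p := fun i => ¬ b.IsPos (w₀ • i)) ?_ ?_
  · intro j hj h
    exact (hw₀ (w₀ * refl Φ j)).not_gt (len_lt_len_mul b w₀ hj h)
  · intro i j k hk hi hj
    refine not_isPos_smul_of_add b w₀ hk hi ?_
    intro h
    exact (hw₀ (w₀ * refl Φ j)).not_gt (len_lt_len_mul b w₀ hj h)

/-- `W₀(u²)` and `W₀(u⁻²)` differ by a power of the unit `u`: if the first is invertible, so is
the second. -/
lemma isUnit_poincare_inv [Finite ι] [Φ.IsRootSystem] [Φ.IsCrystallographic] [Φ.IsReduced]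
    {k : Type*} [CommRing k] (u : kˣ) (h : IsUnit (poincare b ((u : k) ^ 2))) :
    IsUnit (poincare b ((↑u⁻¹ : k) ^ 2)) := by
  obtain ⟨w₀, hw₀⟩ := exists_longest b
  have hneg (i : ι) : b.IsPos (w₀ • i) ↔ ¬ b.IsPos i := by
    refine ⟨fun h hi => hw₀ i hi h, fun h => ?_⟩
    by_contra h'
    rw [← isPos_smul_neg_iff] at h'
    refine hw₀ (Φ.reflectionPerm i i) ?_ h'
    rw [← one_smul Φ.weylGroup (Φ.reflectionPerm i i), isPos_smul_neg_iff, one_smul]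
    exact h
  have hlen (w : Φ.weylGroup) : len b (w₀ * w) + len b w = {i | b.IsPos i}.ncard := by
    rw [← Set.ncard_inter_add_ncard_sdiff_eq_ncard {i | b.IsPos i} {i | b.IsPos (w • i)}
      (Set.toFinite _)]
    change {i | b.IsPos i ∧ ¬ b.IsPos ((w₀ * w) • i)}.ncard +
      {i | b.IsPos i ∧ ¬ b.IsPos (w • i)}.ncard = _
    congr 2
    ext i
    simp [mul_smul, hneg]
  have hsum : poincare b ((u : k) ^ 2) =
      ((u : k) ^ 2) ^ {i | b.IsPos i}.ncard * poincare b ((↑u⁻¹ : k) ^ 2) := by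
    rw [poincare, poincare, Finset.mul_sum, ← Equiv.sum_comp (Equiv.mulLeft w₀)]
    refine Finset.sum_congr rfl fun w _ => ?_
    rw [Equiv.coe_mulLeft, ← hlen w, pow_add, mul_assoc, ← mul_pow, ← mul_pow,
      Units.mul_inv, one_pow, one_pow, mul_one]
  rw [hsum] at h
  exact isUnit_of_mul_isUnit_right h

end Length

/-! ### The affine Hecke algebra -/

section Hecke

variable {Φ : RootPairing ι ℝ M N} (b : Φ.Base)

/-- The element `x^μ` of the group algebra `k[P]` of the weight lattice. -/
def expo (k : Type*) [CommRing k] (μ : weightLattice Φ) : AddMonoidAlgebra k (weightLattice Φ) :=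
  AddMonoidAlgebra.single μ 1

/-- The quotient `(x^μ - x^{s_i μ}) / (1 - x^{-α_i})` in `k[P]`, written out. With
`d = ⟨μ, α_i^∨⟩` it is `∑_{0 ≤ j < d} x^{μ - j α_i}` if `d ≥ 0`, and it is
`-∑_{0 ≤ j < -d} x^{s_i μ - j α_i}` if `d ≤ 0`. -/
def demazure [Φ.IsCrystallographic] (k : Type*) [CommRing k] (i : ι) (μ : weightLattice Φ) :
    AddMonoidAlgebra k (weightLattice Φ) :=
  (∑ j ∈ Finset.range (weightPairing μ i).toNat, expo k (μ - j • rootWeight Φ i)) -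
    ∑ j ∈ Finset.range (-weightPairing μ i).toNat, expo k (refl Φ i • μ - j • rootWeight Φ i)

lemma expo_mul (k : Type*) [CommRing k] (μ ν : weightLattice Φ) :
    expo k μ * expo k ν = expo k (μ + ν) := by
  simp [expo, AddMonoidAlgebra.single_mul_single]

lemma geom_expo (k : Type*) [CommRing k] (μ α : weightLattice Φ) (n : ℕ) :
    (∑ j ∈ Finset.range n, expo k (μ - j • α)) * (1 - expo k (-α)) =
      expo k μ - expo k (μ - n • α) := by
  induction n with
  | zero => simp
  | succ n ih =>
    rw [Finset.sum_range_succ, add_mul, ih, mul_sub, mul_one, expo_mul,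
      show μ - n • α + -α = μ - (n + 1) • α by rw [succ_nsmul]; abel]
    abel

/-- `demazure` is the quotient it is meant to be. -/
lemma demazure_mul [Φ.IsCrystallographic] (k : Type*) [CommRing k] (i : ι)
    (μ : weightLattice Φ) :
    demazure k i μ * (1 - expo k (-rootWeight Φ i)) = expo k μ - expo k (refl Φ i • μ) := by
  rw [demazure, sub_mul, geom_expo, geom_expo, refl_smul_weight]
  rcases le_total 0 (weightPairing μ i) with h | h
  · have h1 : (-weightPairing μ i).toNat = 0 := by omega
    have h2 : (weightPairing μ i).toNat • rootWeight Φ i = weightPairing μ i • rootWeight Φ i := by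
      rw [← natCast_zsmul, Int.toNat_of_nonneg h]
    rw [h1, h2]; simp
  · have h1 : (weightPairing μ i).toNat = 0 := by omega
    have h2 : (-weightPairing μ i).toNat • rootWeight Φ i =
        -(weightPairing μ i • rootWeight Φ i) := by
      rw [← natCast_zsmul, Int.toNat_of_nonneg (by omega), neg_smul]
    rw [h1, h2]; simp

variable (k : Type*) [CommRing k] (q : kˣ)

/-- The free algebra on symbols `T_i` (for the simple roots) and `x^μ` (for the weights). -/
abbrev FreeHecke := FreeAlgebra k (b.support ⊕ weightLattice Φ)

/-- The symbol `T_i`. -/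
abbrev freeT (i : b.support) : FreeHecke b k := FreeAlgebra.ι k (Sum.inl i)

/-- The symbol `x^μ`. -/
abbrev freeX (μ : weightLattice Φ) : FreeHecke b k := FreeAlgebra.ι k (Sum.inr μ)

/-- The order `m_{ij}` of `s_i s_j`; the hyperplanes of `α_i` and `α_j` meet at the angle
`π / m_{ij}`. -/
def braidOrder (i j : b.support) : ℕ := orderOf (simpleRefl b i * simpleRefl b j)

/-- The defining relations of the affine Hecke algebra. -/
inductive Rel [Φ.IsCrystallographic] : FreeHecke b k → FreeHecke b k → Prop
  | braid (i j : b.support) (hij : i ≠ j) :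
      Rel ((CoxeterSystem.alternatingWord i j (braidOrder b i j)).map (freeT b k)).prod
        ((CoxeterSystem.alternatingWord j i (braidOrder b i j)).map (freeT b k)).prod
  | quad (i : b.support) :
      Rel (freeT b k i * freeT b k i) (((q : k) - ↑q⁻¹) • freeT b k i + 1)
  | x_zero : Rel (freeX b k 0) 1
  | x_add (μ ν : weightLattice Φ) : Rel (freeX b k μ * freeX b k ν) (freeX b k (μ + ν))
  | cross (i : b.support) (μ : weightLattice Φ) :
      Rel (freeX b k μ * freeT b k i)
        (freeT b k i * freeX b k (simpleRefl b i • μ) +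
          ((q : k) - ↑q⁻¹) • (demazure k (i : ι) μ).coeff.sum fun ν c => c • freeX b k ν)

/-- The affine Hecke algebra over `k` with parameter `q`, by generators and relations. -/
abbrev Hecke [Φ.IsCrystallographic] := RingQuot (Rel b k q)

variable [Φ.IsCrystallographic]

/-- The generator `T_i` of the affine Hecke algebra. -/
def genT (i : b.support) : Hecke b k q := RingQuot.mkAlgHom k (Rel b k q) (freeT b k i)

/-- The element `x^μ` of the affine Hecke algebra. -/
def genX (μ : weightLattice Φ) : Hecke b k q := RingQuot.mkAlgHom k (Rel b k q) (freeX b k μ)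

/-- The element `T_w = T_{i_1} ⋯ T_{i_p}`, for a reduced word `w = s_{i_1} ⋯ s_{i_p}`. By the braid
relations it does not depend on the reduced word. -/
def stdT [Finite ι] [Φ.IsReduced] (w : Φ.weylGroup) : Hecke b k q :=
  ((reducedWord b w).map (genT b k q)).prod

variable [Finite ι] [Φ.IsReduced] [Φ.IsRootSystem]

/-- The element `𝟏₀ = W₀(q²)⁻¹ ∑_w q^{ℓ(w)} T_w` (meaningful when `W₀(q²)` is invertible). -/
def oneZero : Hecke b k q :=
  Ring.inverse (poincare b ((q : k) ^ 2)) •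
    ∑ w : Φ.weylGroup, ((q : k) ^ len b w) • stdT b k q w

/-- The element `ε₀ = W₀(q⁻²)⁻¹ ∑_w (-q)^{-ℓ(w)} T_w` (meaningful when `W₀(q⁻²)` is invertible). -/
def epsZero : Hecke b k q :=
  Ring.inverse (poincare b ((↑q⁻¹ : k) ^ 2)) •
    ∑ w : Φ.weylGroup, ((-(↑q⁻¹ : k)) ^ len b w) • stdT b k q w

end Hecke

/-! ### The four families of functions -/

section Families

variable {Φ : RootPairing ι ℝ M N} (b : Φ.Base)
variable [Finite ι] [Φ.IsRootSystem] [Φ.IsCrystallographic] [Φ.IsReduced]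

/-- The ring `𝕂 = ℤ[q, q⁻¹]`. -/
abbrev K := LaurentPolynomial ℤ

/-- The ring `𝕂[W₀(q²)⁻¹]`. -/
abbrev KLoc := Localization.Away (poincare b ((LaurentPolynomial.T 1 : K) ^ 2))

/-- The invertible element `q` of `𝕂`. -/
def qK : Kˣ where
  val := LaurentPolynomial.T 1
  inv := LaurentPolynomial.T (-1)
  val_inv := by rw [← LaurentPolynomial.T_add]; simp
  inv_val := by rw [← LaurentPolynomial.T_add]; simp

/-- The invertible element `q` of `𝕂[W₀(q²)⁻¹]`. -/
def qLoc : (KLoc b)ˣ := Units.map (algebraMap K (KLoc b)).toMonoidHom qK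

/-- `W₀(q²)` is invertible in `𝕂[W₀(q²)⁻¹]`. -/
lemma isUnit_poincare_qLoc : IsUnit (poincare b ((qLoc b : KLoc b) ^ 2)) := by
  have h : poincare b ((qLoc b : KLoc b) ^ 2) =
      algebraMap K (KLoc b) (poincare b ((LaurentPolynomial.T 1 : K) ^ 2)) := by
    simp only [poincare, map_sum, map_pow]
    rfl
  rw [h]
  exact IsLocalization.Away.algebraMap_isUnit _

/-- `W₀(q⁻²)` is invertible in `𝕂[W₀(q²)⁻¹]`. -/
lemma isUnit_poincare_qLoc_inv : IsUnit (poincare b ((↑(qLoc b)⁻¹ : KLoc b) ^ 2)) :=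
  isUnit_poincare_inv b (qLoc b) (isUnit_poincare_qLoc b)

variable (Φ) in
/-- The orbit sum `m_μ = ∑_{γ ∈ Wμ} x^γ` in `𝕂[P]`, over the orbit `Wμ = {wμ | w ∈ W}`. -/
def mSym (μ : weightLattice Φ) : AddMonoidAlgebra K (weightLattice Φ) :=
  ∑ γ ∈ (Set.finite_range fun w : Φ.weylGroup => w • μ).toFinset, expo K γ

/-- The alternating sum `a_μ = ∑_{w ∈ W} (-1)^{ℓ(w)} x^{wμ}` in `𝕂[P]`. -/
def aAlt (μ : weightLattice Φ) : AddMonoidAlgebra K (weightLattice Φ) :=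
  ∑ w : Φ.weylGroup, ((-1 : K) ^ len b w) • expo K (w • μ)

/-- `M_μ = 𝟏₀ x^μ 𝟏₀` in the affine Hecke algebra over `𝕂[W₀(q²)⁻¹]`. -/
def bigM (μ : weightLattice Φ) : Hecke b (KLoc b) (qLoc b) :=
  oneZero b (KLoc b) (qLoc b) * genX b (KLoc b) (qLoc b) μ * oneZero b (KLoc b) (qLoc b)

/-- `A_μ = ε₀ x^μ 𝟏₀` in the affine Hecke algebra over `𝕂[W₀(q²)⁻¹]`. -/
def bigA (μ : weightLattice Φ) : Hecke b (KLoc b) (qLoc b) :=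
  epsZero b (KLoc b) (qLoc b) * genX b (KLoc b) (qLoc b) μ * oneZero b (KLoc b) (qLoc b)

/-- The parameter `t = q⁻²`. -/
def tLoc : KLoc b := (↑(qLoc b)⁻¹ : KLoc b) ^ 2

end Families

end AffineHecke

end

/-! The idempotents turn each `T_i` into a scalar: `T_i 𝟏₀ = 𝟏₀ T_i = q 𝟏₀` and `ε₀ T_i = -q⁻¹ ε₀`.
Everything about `M` and `A` follows by evaluating a sandwiched `x^μ T_i` in two ways.

For `A`: the sum `x^μ + x^{s_i μ}` commutes with `T_i`, so `A_μ + A_{s_i μ}` is multiplied by both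
`q` and `-q⁻¹` with equal results. It is therefore killed by `1 + q²`, which divides `W₀(q²)` and is
a unit (`bigA_simpleRefl_smul`).

For `M`: the cross relation between two copies of `𝟏₀` gives `M_{s_i μ} = M_μ - (1 - t) ∑_{0 ≤ j <
d} M_{μ - jα_i}` (`bigM_simpleRefl_smul`). Subtracting the same identity for `μ - α_i`, whose
pairing is `d - 2`, leaves a short recursion, and induction on `d` in steps of two gives the closed
formula (`straightening_formula`).

The long part is the scalar action (`heckeSum_mul_genT`, `genT_mul_heckeSum`). It needs `T_w T_i =
T_{w s_i}` when the length goes up, hence independence of `T_w` from the chosen reduced word. This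
is Matsumoto's theorem (`prod_map_eq_of_wordProd_eq`), proved here from the action on roots. The
statements on `m` and `a` are reindexings over `W`. -/

noncomputable section

namespace AffineHecke

variable {ι M N : Type*} [AddCommGroup M] [Module ℝ M] [AddCommGroup N] [Module ℝ N]

/-! ### Inversions, length and the exchange condition. -/

section Roots

variable {Φ : RootPairing ι ℝ M N} (b : Φ.Base)

lemma root_smul (w : Φ.weylGroup) (i : ι) : Φ.root (w • i) = w • Φ.root i :=
  (Φ.weylGroup_apply_root w i).symm

@[simp]
lemma refl_mul_refl_cancel_left (i : ι) (w : Φ.weylGroup) : refl Φ i * (refl Φ i * w) = w := by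
  rw [← mul_assoc, refl_mul_refl, one_mul]

@[simp]
lemma mul_refl_mul_refl (w : Φ.weylGroup) (i : ι) : w * refl Φ i * refl Φ i = w := by
  rw [mul_assoc, refl_mul_refl, mul_one]

@[simp]
lemma refl_inv (i : ι) : (refl Φ i)⁻¹ = refl Φ i :=
  mul_eq_one_iff_inv_eq.mp (refl_mul_refl Φ i)

@[simp]
lemma refl_smul_refl_smul_idx (j i : ι) : refl Φ j • refl Φ j • i = i := by
  rw [smul_smul, refl_mul_refl, one_smul]

/-- Conjugating a reflection by `w` gives the reflection in the image under `w`. -/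
lemma mul_refl (w : Φ.weylGroup) (i : ι) : w * refl Φ i = refl Φ (w • i) * w := by
  have key (j k : ι) : refl Φ (refl Φ j • k) = refl Φ j * refl Φ k * refl Φ j := by
    apply Subtype.ext
    apply RootPairing.Equiv.weightHom_injective Φ
    apply LinearEquiv.toLinearMap_injective
    ext x
    change Φ.reflection (Φ.reflectionPerm j k) x =
      Φ.reflection j (Φ.reflection k (Φ.reflection j x))
    rw [RootPairing.reflection_reflectionPerm]
    rfl
  obtain ⟨w, hw⟩ := w
  induction hw using RootPairing.weylGroup.induction generalizing i with
  | mem j =>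
    change refl Φ j * refl Φ i = refl Φ (refl Φ j • i) * refl Φ j
    rw [key, mul_refl_mul_refl]
  | one =>
    change 1 * refl Φ i = refl Φ ((1 : Φ.weylGroup) • i) * 1
    rw [one_smul, one_mul, mul_one]
  | mul u v hu hv h1 h2 =>
    change (⟨u, hu⟩ * ⟨v, hv⟩ : Φ.weylGroup) * refl Φ i =
      refl Φ ((⟨u, hu⟩ * ⟨v, hv⟩ : Φ.weylGroup) • i) * (⟨u, hu⟩ * ⟨v, hv⟩)
    rw [mul_assoc, h2, ← mul_assoc, h1, mul_assoc, mul_smul]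

/-- Positivity of a root is positivity of its height, so this linearity decides signs of roots in a
rank two span without coordinates. -/
lemma height_eq_of_root_eq {i j k : ι} {x y : ℤ}
    (hk : Φ.root k = x • Φ.root i + y • Φ.root j) :
    b.height k = x * b.height i + y * b.height j := by
  obtain ⟨f, -, -, hf⟩ := b.exists_root_eq_sum_int i
  obtain ⟨g, -, -, hg⟩ := b.exists_root_eq_sum_int j
  have hfg : Φ.root k = ∑ l ∈ b.support, (x • f + y • g) l • Φ.root l := by
    simp_rw [hk, hf, hg, Pi.add_apply, Pi.smul_apply, add_smul, Finset.sum_add_distrib,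
      Finset.smul_sum, smul_assoc]
  simp_rw [b.height_eq_sum hf, b.height_eq_sum hg, b.height_eq_sum hfg, Pi.add_apply,
    Pi.smul_apply, Finset.sum_add_distrib, Finset.mul_sum, smul_eq_mul]

/-- The coefficients of a positive root with respect to two simple roots are nonnegative. -/
lemma nonneg_of_isPos_of_root_eq {i j : b.support} (hij : i ≠ j) {k : ι} (hpos : b.IsPos k)
    {x y : ℤ} (hk : Φ.root k = x • Φ.root i + y • Φ.root j) : 0 ≤ x ∧ 0 ≤ y := by
  classical
  have hij' : (i : ι) ≠ j := fun h => hij (Subtype.ext h)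
  let f : ι → ℤ := Pi.single (i : ι) x + Pi.single (j : ι) y
  have hfi : f i = x := by simp [f, hij']
  have hfj : f j = y := by simp [f, hij'.symm]
  have hsum : ∑ l ∈ b.support, f l • Φ.root l = Φ.root k := by
    simp_rw [f, Pi.add_apply, add_smul, Finset.sum_add_distrib]
    rw [Finset.sum_eq_single_of_mem (i : ι) i.2 (fun l _ hl => by simp [hl]),
      Finset.sum_eq_single_of_mem (j : ι) j.2 (fun l _ hl => by simp [hl]), hk]
    simp
  have hf₀ : f.support ⊆ b.support := by
    intro l hl
    by_contra hl'
    have h1 : l ≠ i := fun h => hl' (h ▸ i.2)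
    have h2 : l ≠ j := fun h => hl' (h ▸ j.2)
    exact hl (by simp [f, h1, h2])
  have hht := height_eq_of_root_eq b hk
  rw [b.height_one_of_mem_support i.2, b.height_one_of_mem_support j.2] at hht
  have hpos' : 0 < b.height k := hpos
  -- The coefficients of a root all have one sign. If they were nonpositive, the height `x + y`
  -- could not be positive.
  rcases b.pos_or_neg_of_sum_smul_root_mem f ⟨k, hsum.symm⟩ hf₀ with h | h
  · exact ⟨hfi ▸ h.le i, hfj ▸ h.le j⟩
  · have h1 := h.le i
    have h2 := h.le j
    rw [hfi] at h1
    rw [hfj] at h2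
    simp only [Pi.zero_apply] at h1 h2
    omega

lemma isPos_smul_refl_smul_iff (w : Φ.weylGroup) (j : ι) :
    b.IsPos ((w * refl Φ j) • j) ↔ ¬ b.IsPos (w • j) := by
  rw [mul_smul, ← isPos_smul_neg_iff]
  rfl

lemma len_one : len b (1 : Φ.weylGroup) = 0 := by
  have h : {i : ι | b.IsPos i ∧ ¬ b.IsPos ((1 : Φ.weylGroup) • i)} = ∅ := by
    ext i; simp
  change {i : ι | b.IsPos i ∧ ¬ b.IsPos ((1 : Φ.weylGroup) • i)}.ncard = 0
  rw [h, Set.ncard_empty]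

/-- The product of a word in the simple reflections. -/
abbrev wordProd (l : List b.support) : Φ.weylGroup := (l.map (simpleRefl b)).prod

@[simp]
lemma wordProd_nil : wordProd b [] = 1 := rfl

lemma wordProd_append (l l' : List b.support) :
    wordProd b (l ++ l') = wordProd b l * wordProd b l' := by
  simp [wordProd]

lemma wordProd_concat (l : List b.support) (j : b.support) :
    wordProd b (l ++ [j]) = wordProd b l * simpleRefl b j := by
  simp [wordProd]

variable [Finite ι] [Φ.IsCrystallographic] [Φ.IsReduced]

/-- `s_j` permutes the positive roots other than `α_j`, so it carries inversions of `w s_j` to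
inversions of `w`, with `α_j` as the only possible exception. -/
lemma len_mul_le (w : Φ.weylGroup) {j : ι} (hj : j ∈ b.support) :
    len b (w * refl Φ j) ≤ len b w + 1 := by
  let A : Set ι := {i | b.IsPos i ∧ ¬ b.IsPos (w • i)}
  let B : Set ι := {i | b.IsPos i ∧ ¬ b.IsPos ((w * refl Φ j) • i)}
  change B.ncard ≤ A.ncard + 1
  have hsub : B ⊆ insert j ((fun i => refl Φ j • i) '' A) := by
    rintro i ⟨hi, hwi⟩
    by_cases hij : i = j
    · exact Or.inl hij
    · refine Or.inr ⟨refl Φ j • i, ⟨isPos_smul_simple b hi hj hij, ?_⟩,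
        refl_smul_refl_smul_idx j i⟩
      rwa [mul_smul] at hwi
  rw [← Set.ncard_image_of_injective A (MulAction.injective (refl Φ j))]
  exact (Set.ncard_le_ncard hsub (Set.toFinite _)).trans (Set.ncard_insert_le _ _)

lemma len_mul_of_isPos (w : Φ.weylGroup) {j : ι} (hj : j ∈ b.support) (h : b.IsPos (w • j)) :
    len b (w * refl Φ j) = len b w + 1 :=
  le_antisymm (len_mul_le b w hj) (len_lt_len_mul b w hj h)

lemma len_mul_of_not_isPos (w : Φ.weylGroup) {j : ι} (hj : j ∈ b.support)
    (h : ¬ b.IsPos (w • j)) : len b (w * refl Φ j) + 1 = len b w := by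
  rw [← len_mul_of_isPos b (w * refl Φ j) hj ((isPos_smul_refl_smul_iff b w j).2 h),
    mul_refl_mul_refl]

lemma len_wordProd_le (l : List b.support) : len b (wordProd b l) ≤ l.length := by
  induction l using List.reverseRecOn with
  | nil => simp [wordProd, len_one]
  | append_singleton l j ih =>
    rw [wordProd_concat, List.length_append, List.length_singleton]
    exact (len_mul_le b _ j.2).trans (by omega)

/-- The exchange condition. -/
lemma exists_word_of_not_isPos (l : List b.support) (j : b.support)
    (h : ¬ b.IsPos (wordProd b l • (j : ι))) :
    ∃ l' : List b.support, l'.length + 1 = l.length ∧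
      wordProd b l' = wordProd b l * simpleRefl b j := by
  induction l with
  | nil =>
    refine absurd (b.isPos_of_mem_support j.2) ?_
    simpa [wordProd] using h
  | cons a t ih =>
    by_cases ht : b.IsPos (wordProd b t • (j : ι))
    · have hcons : wordProd b (a :: t) = simpleRefl b a * wordProd b t := by simp [wordProd]
      rw [hcons, mul_smul] at h
      -- `s_a` makes a positive root negative only if that root is `α_a`. Conjugation then turns
      -- `s_a t s_j` into `t`, so the letter `a` can be deleted.
      have ha : wordProd b t • (j : ι) = a := by
        by_contra hne
        exact h (isPos_smul_simple b ht a.2 hne)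
      refine ⟨t, by simp, ?_⟩
      rw [hcons, mul_assoc, mul_refl, ha, refl_mul_refl_cancel_left]
    · obtain ⟨l', hl, hp⟩ := ih ht
      refine ⟨a :: l', by simp [hl], ?_⟩
      simp only [wordProd, List.map_cons, List.prod_cons] at hp ⊢
      rw [hp, mul_assoc]

/-- Any word can be processed letter by letter: a letter that raises the length is appended, one
that lowers it is absorbed by the exchange condition. This reconciles `len`, which counts
inversions, with the minimality in `IsReducedWord`. -/
lemma exists_word_length_eq_len (w : Φ.weylGroup) :
    ∃ l : List b.support, wordProd b l = w ∧ l.length = len b w := by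
  obtain ⟨l, rfl⟩ := exists_word b w
  induction l using List.reverseRecOn with
  | nil => exact ⟨[], rfl, by simp [len_one]⟩
  | append_singleton l j ih =>
    obtain ⟨l', hl', hlen⟩ := ih
    change wordProd b l' = wordProd b l at hl'
    change l'.length = len b (wordProd b l) at hlen
    change ∃ l' : List b.support, wordProd b l' = wordProd b (l ++ [j]) ∧
      l'.length = len b (wordProd b (l ++ [j]))
    rw [wordProd_concat]
    by_cases h : b.IsPos (wordProd b l • (j : ι))
    · refine ⟨l' ++ [j], by rw [wordProd_concat, hl'], ?_⟩
      rw [len_mul_of_isPos b _ j.2 h, List.length_append, hlen, List.length_singleton]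
    · have h2 := len_mul_of_not_isPos b _ j.2 h
      rw [← hl'] at h
      obtain ⟨l'', hlen'', hp⟩ := exists_word_of_not_isPos b l' j h
      exact ⟨l'', by rw [hp, hl'], by change _ = len b (wordProd b l * refl Φ j); omega⟩

lemma length_reducedWord (w : Φ.weylGroup) : (reducedWord b w).length = len b w := by
  obtain ⟨h1, h2⟩ := reducedWord_spec b w
  obtain ⟨l, hl, hlen⟩ := exists_word_length_eq_len b w
  refine le_antisymm (hlen ▸ h2 l hl) ?_
  have := len_wordProd_le b (reducedWord b w)
  rwa [wordProd, h1] at this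

lemma wordProd_reducedWord (w : Φ.weylGroup) : wordProd b (reducedWord b w) = w :=
  (reducedWord_spec b w).1

lemma len_inv (w : Φ.weylGroup) : len b w⁻¹ = len b w := by
  have key (w : Φ.weylGroup) : len b w⁻¹ ≤ len b w := by
    obtain ⟨l, rfl, hlen⟩ := exists_word_length_eq_len b w
    have h : (wordProd b l)⁻¹ = wordProd b l.reverse := by
      simp [wordProd, List.prod_inv_reverse, List.map_reverse, Function.comp_def]
    rw [← hlen, h, ← List.length_reverse]
    exact len_wordProd_le b _
  exact le_antisymm (key w) (by simpa using key w⁻¹)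

end Roots

/-! ### Dihedral subgroups and Matsumoto's theorem. -/

section Matsumoto

open CoxeterSystem

variable {Φ : RootPairing ι ℝ M N} (b : Φ.Base)

lemma wordProd_alternatingWord_succ (i j : b.support) (k : ℕ) :
    wordProd b (alternatingWord i j (k + 1)) =
      wordProd b (alternatingWord j i k) * simpleRefl b j := by
  rw [alternatingWord_succ, List.concat_eq_append, wordProd_concat]

/-- Links the order of `s_i s_j` with alternating words: those of length `k` starting from either
letter agree exactly when the `k`-th power is trivial. -/
lemma inv_mul_wordProd_alternatingWord (i j : b.support) (k : ℕ) :
    (wordProd b (alternatingWord j i k))⁻¹ * wordProd b (alternatingWord i j k) =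
      (simpleRefl b i * simpleRefl b j) ^ k := by
  induction k generalizing i j with
  | zero => simp [alternatingWord]
  | succ k ih =>
    have h : SemiconjBy (simpleRefl b j) (simpleRefl b i * simpleRefl b j)
      (simpleRefl b j * simpleRefl b i) := (mul_assoc _ _ _).symm
    calc (wordProd b (alternatingWord j i (k + 1)))⁻¹ * wordProd b (alternatingWord i j (k + 1))
        = simpleRefl b i * (((wordProd b (alternatingWord i j k))⁻¹ *
            wordProd b (alternatingWord j i k)) * simpleRefl b j) := by
          rw [wordProd_alternatingWord_succ, wordProd_alternatingWord_succ, mul_inv_rev, refl_inv]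
          simp only [mul_assoc]
      _ = (simpleRefl b i * simpleRefl b j) ^ (k + 1) := by
          rw [ih, ← (h.pow_right k).eq, pow_succ', mul_assoc]

lemma braidOrder_comm (i j : b.support) : braidOrder b i j = braidOrder b j i := by
  rw [braidOrder, braidOrder, ← orderOf_inv, mul_inv_rev, refl_inv, refl_inv]

lemma wordProd_alternatingWord_braidOrder (i j : b.support) :
    wordProd b (alternatingWord i j (braidOrder b i j)) =
      wordProd b (alternatingWord j i (braidOrder b i j)) := by
  have h := inv_mul_wordProd_alternatingWord b i j (braidOrder b i j)
  rw [braidOrder, pow_orderOf_eq_one, inv_mul_eq_one] at h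
  exact h.symm

/-- Extending an alternating word by one letter on the left. -/
lemma wordProd_alternatingWord_succ' (i j : b.support) (k : ℕ) :
    wordProd b (alternatingWord i j (k + 1)) =
      simpleRefl b (if Even k then j else i) * wordProd b (alternatingWord i j k) := by
  rw [alternatingWord_succ']
  simp [wordProd]

variable [Finite ι] [Φ.IsCrystallographic] [Φ.IsReduced]

/-- Alternating words of length at most the order `m_{ij}` are reduced. -/
lemma isPos_inv_wordProd_alternatingWord_smul {i j : b.support} (hij : i ≠ j) {k : ℕ}
    (hk : k < braidOrder b i j) :
    b.IsPos ((wordProd b (alternatingWord i j k))⁻¹ •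
      ((if Even k then j else i : b.support) : ι)) := by
  induction k generalizing i j with
  | zero => simpa [alternatingWord] using RootPairing.Base.isPos_of_mem_support j.2
  | succ k ih =>
    have hk' : k < braidOrder b j i := by rw [braidOrder_comm]; omega
    have h := ih hij.symm hk'
    have hc : (if Even (k + 1) then j else i) = if Even k then i else j := by
      by_cases he : Even k <;> simp [he, Nat.even_add_one]
    rw [hc, wordProd_alternatingWord_succ, mul_inv_rev, refl_inv, mul_smul]
    -- If the root here were `α_j`, conjugation would make the two alternating words of length `k +
    -- 1` equal, forcing `(s_i s_j)^(k+1) = 1` with `k + 1` below the order.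
    refine isPos_smul_simple b h j.2 fun heq => ?_
    have h1 := wordProd_alternatingWord_succ' b j i k
    have h2 := mul_refl (wordProd b (alternatingWord j i k))⁻¹
      ((if Even k then i else j : b.support) : ι)
    rw [heq] at h2
    have h3 : wordProd b (alternatingWord j i (k + 1)) =
        wordProd b (alternatingWord i j (k + 1)) := by
      rw [h1, wordProd_alternatingWord_succ]
      rw [inv_mul_eq_iff_eq_mul, ← mul_assoc, eq_mul_inv_iff_mul_eq] at h2
      exact h2
    have h4 := inv_mul_wordProd_alternatingWord b i j (k + 1)
    rw [h3, inv_mul_cancel] at h4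
    exact absurd (Nat.le_of_dvd k.succ_pos (orderOf_dvd_of_pow_eq_one h4.symm)) (by
      change ¬ braidOrder b i j ≤ k + 1
      omega)

omit [Finite ι] [Φ.IsReduced] in
lemma exists_root_refl_smul_eq (i j : ι) {k : ι} {x y : ℤ}
    (hk : Φ.root k = x • Φ.root i + y • Φ.root j) :
    ∃ x' y' : ℤ, Φ.root (refl Φ j • k) = x' • Φ.root i + y' • Φ.root j := by
  refine ⟨x, y - Φ.pairingIn ℤ k j, ?_⟩
  change Φ.root (Φ.reflectionPerm j k) = _
  rw [RootPairing.root_reflectionPerm, RootPairing.reflection_apply_root' ℤ, hk]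
  module

omit [Finite ι] [Φ.IsReduced] in
lemma exists_root_inv_wordProd_alternatingWord_smul_eq (i j : b.support) (p : ℕ) {k : ι}
    {x y : ℤ} (hk : Φ.root k = x • Φ.root i + y • Φ.root j) :
    ∃ x' y' : ℤ, Φ.root ((wordProd b (alternatingWord i j p))⁻¹ • k) =
      x' • Φ.root i + y' • Φ.root j := by
  induction p generalizing i j x y with
  | zero => exact ⟨x, y, by simpa [alternatingWord] using hk⟩
  | succ p ih =>
    rw [wordProd_alternatingWord_succ, mul_inv_rev, refl_inv, mul_smul]
    obtain ⟨x', y', h⟩ := ih j i (x := y) (y := x) (by rw [hk, add_comm])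
    exact exists_root_refl_smul_eq (i : ι) j (x := y') (y := x') (by rw [h, add_comm])

/-- If `w` sends `α_i` and `α_j` to negative roots, then `w` ends in every alternating word in
`i`, `j` of length at most `m_{ij}`. -/
lemma len_mul_inv_wordProd_alternatingWord {i j : b.support} (hij : i ≠ j) (w : Φ.weylGroup)
    (hi : ¬ b.IsPos (w • (i : ι))) (hj : ¬ b.IsPos (w • (j : ι))) {k : ℕ}
    (hk : k ≤ braidOrder b i j) :
    len b (w * (wordProd b (alternatingWord i j k))⁻¹) + k = len b w := by
  induction k with
  | zero => simp [alternatingWord]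
  | succ k ih =>
    rw [← ih (by omega), wordProd_alternatingWord_succ', mul_inv_rev, refl_inv, ← mul_assoc]
    have hpos := isPos_inv_wordProd_alternatingWord_smul b hij (k := k) (by omega)
    set c : b.support := if Even k then j else i with hc
    obtain ⟨x, y, hxy⟩ : ∃ x y : ℤ, Φ.root c = x • Φ.root i + y • Φ.root j := by
      by_cases he : Even k
      · exact ⟨0, 1, by simp [hc, he]⟩
      · exact ⟨1, 0, by simp [hc, he]⟩
    obtain ⟨x', y', h⟩ := exists_root_inv_wordProd_alternatingWord_smul_eq b i j k hxy
    obtain ⟨hx, hy⟩ := nonneg_of_isPos_of_root_eq b hij hpos h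
    -- The shorter word sends `α_c` to a nonnegative combination of `α_i` and `α_j`. Since `w` gives
    -- both nonpositive height, each further letter removed shortens `w` by one.
    have hneg : ¬ b.IsPos ((w * (wordProd b (alternatingWord i j k))⁻¹) • (c : ι)) := by
      have hroot : Φ.root (w • (wordProd b (alternatingWord i j k))⁻¹ • (c : ι)) =
          x' • Φ.root (w • (i : ι)) + y' • Φ.root (w • (j : ι)) := by
        rw [root_smul, h, root_smul, root_smul, smul_add, smul_comm w, smul_comm w]
      rw [mul_smul, RootPairing.Base.isPos_iff, height_eq_of_root_eq b hroot]
      rw [RootPairing.Base.isPos_iff] at hi hj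
      nlinarith
    have := len_mul_of_not_isPos b _ c.2 hneg
    change len b (_ * refl Φ c) + (k + 1) = _
    omega

lemma not_isPos_wordProd_concat_smul {l : List b.support} {j : b.support}
    (h : (l ++ [j]).length = len b (wordProd b (l ++ [j]))) :
    ¬ b.IsPos (wordProd b (l ++ [j]) • (j : ι)) := by
  intro hpos
  have h1 := len_mul_of_isPos b _ j.2 hpos
  have h2 := len_wordProd_le b l
  rw [wordProd_concat] at h h1
  change len b (wordProd b l * refl Φ j * refl Φ j) = _ at h1
  rw [mul_refl_mul_refl] at h1
  rw [List.length_append, List.length_singleton] at h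
  omega

lemma length_eq_len_of_concat {l : List b.support} {j : b.support}
    (h : (l ++ [j]).length = len b (wordProd b (l ++ [j]))) :
    l.length = len b (wordProd b l) := by
  have h1 := len_mul_le b (wordProd b l) j.2
  have h2 := len_wordProd_le b l
  rw [wordProd_concat, List.length_append, List.length_singleton] at h
  change _ = len b (wordProd b l * refl Φ j) at h
  omega

omit [Φ.IsCrystallographic] [Φ.IsReduced] in
lemma braidOrder_pos [Φ.IsRootSystem] (i j : b.support) : 0 < braidOrder b i j :=
  orderOf_pos _

/-- Matsumoto's theorem: a map from the simple reflections to a monoid that satisfies the braid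
relations takes the same value on all reduced words of an element. -/
theorem prod_map_eq_of_wordProd_eq [Φ.IsRootSystem] {A : Type*} [Monoid A] (f : b.support → A)
    (hf : ∀ i j, i ≠ j → ((alternatingWord i j (braidOrder b i j)).map f).prod =
      ((alternatingWord j i (braidOrder b i j)).map f).prod)
    {l l' : List b.support} (hl : l.length = len b (wordProd b l))
    (hl' : l'.length = len b (wordProd b l')) (h : wordProd b l = wordProd b l') :
    (l.map f).prod = (l'.map f).prod := by
  induction hn : l.length generalizing l l' with
  | zero =>
    have h0 : l'.length = 0 := by rw [hl', ← h, ← hl, hn]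
    rw [List.length_eq_zero_iff.mp hn, List.length_eq_zero_iff.mp h0]
  | succ n ih =>
    have hn' : l'.length = n + 1 := by rw [hl', ← h, ← hl, hn]
    obtain ⟨u, i, rfl⟩ : ∃ u i, l = u ++ [i] :=
      (List.eq_nil_or_concat' l).resolve_left (by rintro rfl; simp at hn)
    obtain ⟨u', j, rfl⟩ : ∃ u' j, l' = u' ++ [j] :=
      (List.eq_nil_or_concat' l').resolve_left (by rintro rfl; simp at hn')
    have hu := length_eq_len_of_concat b hl
    have hu' := length_eq_len_of_concat b hl'
    -- two reduced words with the same last letter have the same product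
    have same {v v' : List b.support} {c : b.support}
        (hv : (v ++ [c]).length = len b (wordProd b (v ++ [c])))
        (hv' : (v' ++ [c]).length = len b (wordProd b (v' ++ [c])))
        (hvv : wordProd b (v ++ [c]) = wordProd b (v' ++ [c]))
        (hlen : (v ++ [c]).length = n + 1) :
        ((v ++ [c]).map f).prod = ((v' ++ [c]).map f).prod := by
      have := ih (length_eq_len_of_concat b hv) (length_eq_len_of_concat b hv')
        (by rwa [wordProd_concat, wordProd_concat, mul_left_inj] at hvv) (by simpa using hlen)
      simp [this]
    by_cases hij : i = j
    · subst hij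
      exact same hl hl' h hn
    · set m := braidOrder b i j
      set w := wordProd b (u ++ [i])
      have hwi : ¬ b.IsPos (w • (i : ι)) := not_isPos_wordProd_concat_smul b hl
      have hwj : ¬ b.IsPos (w • (j : ι)) := h ▸ not_isPos_wordProd_concat_smul b hl'
      -- Both `i` and `j` are right descents of `w`, so `w` factors with added lengths as a `v`
      -- times the alternating word of length `m`, which may be written ending in `i` or in `j`.
      have hdesc := len_mul_inv_wordProd_alternatingWord b hij w hwi hwj le_rfl
      obtain ⟨v, hv, hvlen⟩ :=
        exists_word_length_eq_len b (w * (wordProd b (alternatingWord i j m))⁻¹)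
      -- Finiteness of `W` rules out `orderOf` taking its default value `0`; the alternating words
      -- thus have a last letter.
      have hmpos : m ≠ 0 := (braidOrder_pos b i j).ne'
      obtain ⟨p, hp⟩ := Nat.exists_eq_succ_of_ne_zero hmpos
      have e1 : wordProd b (v ++ alternatingWord i j m) = w := by
        rw [wordProd_append, hv, inv_mul_cancel_right]
      have e2 : wordProd b (v ++ alternatingWord j i m) = w := by
        rw [wordProd_append, ← wordProd_alternatingWord_braidOrder, ← wordProd_append, e1]
      have l1 : (v ++ alternatingWord i j m).length = len b w := by
        rw [List.length_append, length_alternatingWord, hvlen, hdesc]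
      have l2 : (v ++ alternatingWord j i m).length = len b w := by
        rw [List.length_append, length_alternatingWord, hvlen, hdesc]
      have s1 : v ++ alternatingWord i j m = (v ++ alternatingWord j i p) ++ [j] := by
        rw [hp, alternatingWord_succ, List.concat_eq_append, List.append_assoc]
      have s2 : v ++ alternatingWord j i m = (v ++ alternatingWord i j p) ++ [i] := by
        rw [hp, alternatingWord_succ, List.concat_eq_append, List.append_assoc]
      -- The outer two equalities compare words with a common last letter, where induction applies;
      -- the middle one is the braid relation.
      calc ((u ++ [i]).map f).prod = ((v ++ alternatingWord j i m).map f).prod := by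
            rw [s2] at e2 l2 ⊢
            exact same hl (by rw [l2, e2]) e2.symm hn
        _ = ((v ++ alternatingWord i j m).map f).prod := by
            rw [List.map_append, List.prod_append, ← hf i j hij, List.map_append,
              List.prod_append]
        _ = ((u' ++ [j]).map f).prod := by
            rw [s1] at e1 l1 ⊢
            exact same (by rw [l1, e1]) hl' (e1.trans h) (by rw [l1, ← hn, hl])

end Matsumoto

/-! ### Relations in the affine Hecke algebra and eigenvectors of the `T_i`. -/

section HeckeRelations

variable {Φ : RootPairing ι ℝ M N} (b : Φ.Base) (k : Type*) [CommRing k] (q : kˣ)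
variable [Φ.IsCrystallographic]

lemma genT_braid {i j : b.support} (hij : i ≠ j) :
    ((CoxeterSystem.alternatingWord i j (braidOrder b i j)).map (genT b k q)).prod =
      ((CoxeterSystem.alternatingWord j i (braidOrder b i j)).map (genT b k q)).prod := by
  have h := RingQuot.mkAlgHom_rel k (Rel.braid (k := k) (q := q) i j hij)
  rw [map_list_prod, map_list_prod, List.map_map, List.map_map] at h
  exact h

lemma genT_mul_genT (i : b.support) :
    genT b k q i * genT b k q i = ((q : k) - ↑q⁻¹) • genT b k q i + 1 := by
  have h := RingQuot.mkAlgHom_rel k (Rel.quad (b := b) (q := q) i)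
  rw [map_mul, map_add, map_smul, map_one] at h
  exact h

/-- The `k`-linear map sending `x^μ` in the group algebra to `x^μ` in the affine Hecke algebra. -/
def ofGroupAlgebra (f : AddMonoidAlgebra k (weightLattice Φ)) : Hecke b k q :=
  Finsupp.linearCombination k (genX b k q) f.coeff

lemma ofGroupAlgebra_expo (μ : weightLattice Φ) :
    ofGroupAlgebra b k q (expo k μ) = genX b k q μ := by
  simp [ofGroupAlgebra, expo]

lemma ofGroupAlgebra_sum {σ : Type*} (s : Finset σ)
    (f : σ → AddMonoidAlgebra k (weightLattice Φ)) :
    ofGroupAlgebra b k q (∑ j ∈ s, f j) = ∑ j ∈ s, ofGroupAlgebra b k q (f j) := by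
  simp [ofGroupAlgebra]

lemma ofGroupAlgebra_neg (f : AddMonoidAlgebra k (weightLattice Φ)) :
    ofGroupAlgebra b k q (-f) = -ofGroupAlgebra b k q f := by
  simp [ofGroupAlgebra]

lemma genX_mul_genT (i : b.support) (μ : weightLattice Φ) :
    genX b k q μ * genT b k q i = genT b k q i * genX b k q (simpleRefl b i • μ) +
      ((q : k) - ↑q⁻¹) • ofGroupAlgebra b k q (demazure k (i : ι) μ) := by
  have h := RingQuot.mkAlgHom_rel k (Rel.cross (b := b) (q := q) i μ)
  rw [map_mul, map_add, map_smul, map_mul, Finsupp.sum, map_sum] at h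
  simp_rw [map_smul] at h
  exact h

lemma weightPairing_refl_smul (i : ι) (μ : weightLattice Φ) :
    weightPairing (refl Φ i • μ) i = -weightPairing μ i := by
  have h1 := weightPairing_spec (refl Φ i • μ) i
  have h2 := weightPairing_spec μ i
  rw [refl_smul_weight] at h1
  have h3 : Φ.toLinearMap (Φ.root i) (Φ.coroot i) = 2 := Φ.root_coroot_two i
  have h4 : ((μ - weightPairing μ i • rootWeight Φ i : weightLattice Φ) : M) =
      (μ : M) - (weightPairing μ i : ℝ) • Φ.root i := by
    rw [Int.cast_smul_eq_zsmul]; rfl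
  rw [h4, map_sub, map_smul, LinearMap.sub_apply, LinearMap.smul_apply, h2, h3,
    ← refl_smul_weight, smul_eq_mul] at h1
  have : ((weightPairing (refl Φ i • μ) i : ℤ) : ℝ) = ((-weightPairing μ i : ℤ) : ℝ) := by
    rw [← h1]; push_cast; ring
  exact_mod_cast this

lemma refl_smul_refl_smul_weight (i : ι) (μ : weightLattice Φ) :
    refl Φ i • refl Φ i • μ = μ := by
  rw [smul_smul, refl_mul_refl, one_smul]

lemma demazure_refl_smul (i : ι) (μ : weightLattice Φ) :
    demazure k i (refl Φ i • μ) = -demazure k i μ := by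
  rw [demazure, demazure, weightPairing_refl_smul, refl_smul_refl_smul_weight, neg_neg, neg_sub]

/-- `x^μ + x^{s_i μ}` commutes with `T_i`. -/
lemma add_genX_mul_genT (i : b.support) (μ : weightLattice Φ) :
    (genX b k q μ + genX b k q (simpleRefl b i • μ)) * genT b k q i =
      genT b k q i * (genX b k q μ + genX b k q (simpleRefl b i • μ)) := by
  -- The quotient is antisymmetric under `s_i`, so the two correction terms cancel.
  rw [add_mul, genX_mul_genT, genX_mul_genT, refl_smul_refl_smul_weight, demazure_refl_smul,
    ofGroupAlgebra_neg, smul_neg, mul_add]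
  abel

lemma genX_mul_genT_of_weightPairing_eq (i : b.support) (μ : weightLattice Φ) {d : ℕ}
    (hd : weightPairing μ (i : ι) = d) :
    genX b k q μ * genT b k q i = genT b k q i * genX b k q (simpleRefl b i • μ) +
      ((q : k) - ↑q⁻¹) • ∑ j ∈ Finset.range d, genX b k q (μ - j • rootWeight Φ (i : ι)) := by
  rw [genX_mul_genT, demazure, hd]
  simp [ofGroupAlgebra_sum, ofGroupAlgebra_expo]

variable [Finite ι] [Φ.IsReduced] [Φ.IsRootSystem]

lemma prod_map_genT_eq_stdT {l : List b.support} (hl : l.length = len b (wordProd b l)) :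
    (l.map (genT b k q)).prod = stdT b k q (wordProd b l) :=
  prod_map_eq_of_wordProd_eq b (genT b k q) (fun _ _ hij => genT_braid b k q hij) hl
    (by rw [length_reducedWord, wordProd_reducedWord]) (wordProd_reducedWord b _).symm

/-- Appending `i` to the chosen word of `w` gives a reduced word of `w s_i`, usually not the chosen
one; Matsumoto's theorem removes the difference. -/
lemma stdT_mul_genT_of_isPos (w : Φ.weylGroup) (i : b.support) (h : b.IsPos (w • (i : ι))) :
    stdT b k q w * genT b k q i = stdT b k q (w * simpleRefl b i) := by
  have hw := wordProd_concat b (reducedWord b w) i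
  rw [wordProd_reducedWord] at hw
  rw [← hw, ← prod_map_genT_eq_stdT]
  · simp [stdT]
  · rw [hw, len_mul_of_isPos b w i.2 h, List.length_append, length_reducedWord,
      List.length_singleton]

lemma stdT_mul_genT_of_not_isPos (w : Φ.weylGroup) (i : b.support)
    (h : ¬ b.IsPos (w • (i : ι))) :
    stdT b k q w * genT b k q i =
      ((q : k) - ↑q⁻¹) • stdT b k q w + stdT b k q (w * simpleRefl b i) := by
  have h1 := stdT_mul_genT_of_isPos b k q (w * simpleRefl b i) i
    ((isPos_smul_refl_smul_iff b w i).2 h)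
  rw [mul_refl_mul_refl] at h1
  rw [← h1, mul_assoc, genT_mul_genT, mul_add, mul_one, mul_smul_comm]

omit [Φ.IsRootSystem] in
lemma len_mul_left (w : Φ.weylGroup) (i : b.support) :
    len b (simpleRefl b i * w) = len b (w⁻¹ * simpleRefl b i) := by
  rw [← len_inv, mul_inv_rev, refl_inv]

lemma genT_mul_stdT_of_isPos (w : Φ.weylGroup) (i : b.support) (h : b.IsPos (w⁻¹ • (i : ι))) :
    genT b k q i * stdT b k q w = stdT b k q (simpleRefl b i * w) := by
  have hw : wordProd b (i :: reducedWord b w) = simpleRefl b i * w := by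
    rw [wordProd, List.map_cons, List.prod_cons]
    exact congrArg _ (wordProd_reducedWord b w)
  rw [← hw, ← prod_map_genT_eq_stdT]
  · simp [stdT]
  · rw [hw, len_mul_left, len_mul_of_isPos b _ i.2 h, len_inv, List.length_cons,
      length_reducedWord]

lemma genT_mul_stdT_of_not_isPos (w : Φ.weylGroup) (i : b.support)
    (h : ¬ b.IsPos (w⁻¹ • (i : ι))) :
    genT b k q i * stdT b k q w =
      ((q : k) - ↑q⁻¹) • stdT b k q w + stdT b k q (simpleRefl b i * w) := by
  have h1 := genT_mul_stdT_of_isPos b k q (simpleRefl b i * w) i (by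
    rw [mul_inv_rev, refl_inv]
    exact (isPos_smul_refl_smul_iff b w⁻¹ i).2 h)
  rw [refl_mul_refl_cancel_left] at h1
  rw [← h1, ← mul_assoc, genT_mul_genT, add_mul, one_mul, smul_mul_assoc]

/-- The element `∑_w u^{ℓ(w)} T_w`. -/
def heckeSum (u : k) : Hecke b k q := ∑ w : Φ.weylGroup, u ^ len b w • stdT b k q w

variable {k q} in
/-- If `u` is a root of the quadratic relation, then `∑_w u^{ℓ(w)} T_w` is an eigenvector for right
multiplication by `T_i` with eigenvalue `u`. -/
lemma heckeSum_mul_genT {u : k} (hu : u * u = ((q : k) - ↑q⁻¹) * u + 1) (i : b.support) :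
    heckeSum b k q u * genT b k q i = u • heckeSum b k q u := by
  classical
  have key (w : Φ.weylGroup) : (u ^ len b w • stdT b k q w) * genT b k q i =
      u ^ len b w • stdT b k q (w * simpleRefl b i) +
        (if b.IsPos (w • (i : ι)) then 0 else
          (((q : k) - ↑q⁻¹) * u ^ len b w)) • stdT b k q w := by
    rw [smul_mul_assoc]
    split_ifs with h
    · rw [stdT_mul_genT_of_isPos b k q w i h, zero_smul, add_zero]
    · rw [stdT_mul_genT_of_not_isPos b k q w i h, smul_add, smul_smul, add_comm, mul_comm (u ^ _)]
  -- After this substitution one compares coefficients of `T_w`: an ascent gives `u^{ℓ(w)+1}` at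
  -- once, a descent gives `u^{ℓ(w)-1} (1 + (q - q⁻¹) u)`, which equals it by `hu`.
  have reindex : ∑ w : Φ.weylGroup, u ^ len b w • stdT b k q (w * simpleRefl b i) =
      ∑ w : Φ.weylGroup, u ^ len b (w * simpleRefl b i) • stdT b k q w := by
    rw [← Equiv.sum_comp (Equiv.mulRight (simpleRefl b i))]
    simp
  rw [heckeSum, Finset.sum_mul, Finset.sum_congr rfl fun w _ => key w, Finset.sum_add_distrib,
    reindex, ← Finset.sum_add_distrib, Finset.smul_sum]
  refine Finset.sum_congr rfl fun w _ => ?_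
  rw [← add_smul, smul_smul]
  congr 1
  split_ifs with h
  · rw [len_mul_of_isPos b w i.2 h]; ring
  · rw [← len_mul_of_not_isPos b w i.2 h]
    linear_combination (-u ^ len b (w * refl Φ i)) * hu

variable {k q} in
lemma genT_mul_heckeSum {u : k} (hu : u * u = ((q : k) - ↑q⁻¹) * u + 1) (i : b.support) :
    genT b k q i * heckeSum b k q u = u • heckeSum b k q u := by
  classical
  have key (w : Φ.weylGroup) : genT b k q i * (u ^ len b w • stdT b k q w) =
      u ^ len b w • stdT b k q (simpleRefl b i * w) +
        (if b.IsPos (w⁻¹ • (i : ι)) then 0 else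
          (((q : k) - ↑q⁻¹) * u ^ len b w)) • stdT b k q w := by
    rw [mul_smul_comm]
    split_ifs with h
    · rw [genT_mul_stdT_of_isPos b k q w i h, zero_smul, add_zero]
    · rw [genT_mul_stdT_of_not_isPos b k q w i h, smul_add, smul_smul, add_comm, mul_comm (u ^ _)]
  have reindex : ∑ w : Φ.weylGroup, u ^ len b w • stdT b k q (simpleRefl b i * w) =
      ∑ w : Φ.weylGroup, u ^ len b (simpleRefl b i * w) • stdT b k q w := by
    rw [← Equiv.sum_comp (Equiv.mulLeft (simpleRefl b i))]
    simp
  rw [heckeSum, Finset.mul_sum, Finset.sum_congr rfl fun w _ => key w, Finset.sum_add_distrib,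
    reindex, ← Finset.sum_add_distrib, Finset.smul_sum]
  refine Finset.sum_congr rfl fun w _ => ?_
  rw [← add_smul, smul_smul, len_mul_left, ← len_inv b w]
  congr 1
  split_ifs with h
  · rw [len_mul_of_isPos b _ i.2 h]; ring
  · rw [← len_mul_of_not_isPos b _ i.2 h]
    linear_combination (-u ^ len b (w⁻¹ * refl Φ i)) * hu

variable {k} in
-- The pairs `{w, w s_i}` partition `W`, with lengths differing by one, so `1 + v` is a factor of
-- `W₀(v)`.
lemma isUnit_one_add_of_isUnit_poincare (i : b.support) {v : k} (h : IsUnit (poincare b v)) :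
    IsUnit (1 + v) := by
  classical
  have hsplit : poincare b v =
      (1 + v) * ∑ w : Φ.weylGroup with b.IsPos (w • (i : ι)), v ^ len b w := by
    rw [poincare, ← Finset.sum_filter_add_sum_filter_not _ fun w => b.IsPos (w • (i : ι)),
      add_mul, one_mul, Finset.mul_sum]
    congr 1
    symm
    refine Finset.sum_bij' (fun w _ => w * simpleRefl b i) (fun w _ => w * simpleRefl b i)
      ?_ ?_ ?_ ?_ ?_
    · intro w hw
      rw [Finset.mem_filter] at hw ⊢
      refine ⟨Finset.mem_univ _, fun h' => ?_⟩
      rw [isPos_smul_refl_smul_iff] at h'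
      exact h' hw.2
    · intro w hw
      rw [Finset.mem_filter] at hw ⊢
      exact ⟨Finset.mem_univ _, (isPos_smul_refl_smul_iff b w i).2 hw.2⟩
    · intro w _; exact mul_refl_mul_refl w _
    · intro w _; exact mul_refl_mul_refl w _
    · intro w hw
      rw [Finset.mem_filter] at hw
      rw [len_mul_of_isPos b w i.2 hw.2, pow_succ']
  rw [hsplit] at h
  exact isUnit_of_mul_isUnit_left h

lemma oneZero_mul_genT (i : b.support) :
    oneZero b k q * genT b k q i = (q : k) • oneZero b k q := by
  change (Ring.inverse _ • heckeSum b k q q) * _ = _ • (Ring.inverse _ • heckeSum b k q q)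
  rw [smul_mul_assoc, heckeSum_mul_genT b (by rw [sub_mul, Units.inv_mul]; ring), smul_comm]

lemma genT_mul_oneZero (i : b.support) :
    genT b k q i * oneZero b k q = (q : k) • oneZero b k q := by
  change _ * (Ring.inverse _ • heckeSum b k q q) = _ • (Ring.inverse _ • heckeSum b k q q)
  rw [mul_smul_comm, genT_mul_heckeSum b (by rw [sub_mul, Units.inv_mul]; ring), smul_comm]

lemma epsZero_mul_genT (i : b.support) :
    epsZero b k q * genT b k q i = (-(↑q⁻¹ : k)) • epsZero b k q := by
  change (Ring.inverse _ • heckeSum b k q (-↑q⁻¹)) * _ =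
    _ • (Ring.inverse _ • heckeSum b k q (-↑q⁻¹))
  rw [smul_mul_assoc, heckeSum_mul_genT b (by rw [sub_mul, mul_neg (q : k), Units.mul_inv]; ring),
    smul_comm]

end HeckeRelations

/-! ### The straightening recursion and its solution. -/

section Straightening

variable {Φ : RootPairing ι ℝ M N}

lemma weightPairing_eq_of_toLinearMap_eq {i : ι} {μ : weightLattice Φ} {z : ℤ}
    (h : Φ.toLinearMap (μ : M) (Φ.coroot i) = (z : ℝ)) : weightPairing μ i = z := by
  rw [weightPairing_spec] at h
  exact_mod_cast h

variable [Φ.IsCrystallographic]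

lemma weightPairing_sub_rootWeight (i : ι) (μ : weightLattice Φ) :
    weightPairing (μ - rootWeight Φ i) i = weightPairing μ i - 2 := by
  apply weightPairing_eq_of_toLinearMap_eq
  have h : Φ.toLinearMap (Φ.root i) (Φ.coroot i) = 2 := Φ.root_coroot_two i
  change Φ.toLinearMap ((μ : M) - Φ.root i) (Φ.coroot i) = _
  rw [map_sub, LinearMap.sub_apply, weightPairing_spec, h]
  push_cast
  rfl

lemma refl_smul_eq_sub_nsmul {i : ι} {μ : weightLattice Φ} {d : ℕ} (hd : weightPairing μ i = d) :
    refl Φ i • μ = μ - d • rootWeight Φ i := by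
  rw [refl_smul_weight, hd, natCast_zsmul]

variable {k V : Type*} [CommRing k] [AddCommGroup V] [Module k V]

lemma sum_Icc_one_eq_sum_range (n : ℕ) (f : ℕ → V) :
    ∑ j ∈ Finset.Icc 1 n, f j = ∑ j ∈ Finset.range n, f (j + 1) := by
  induction n with
  | zero => simp
  | succ n ih => rw [Finset.sum_Icc_succ_top (by omega), ih, Finset.sum_range_succ]

/-- A function on weights with `F(s_i μ) = F(μ) - (1 - t) ∑_{0 ≤ j < d} F(μ - j α_i)` for all
`μ` with `d = ⟨μ, α_i^∨⟩ ≥ 0` satisfies a two-step recursion. -/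
lemma straightening_step {i : ι} {t : k} {F : weightLattice Φ → V}
    (hF : ∀ (μ : weightLattice Φ) (d : ℕ), weightPairing μ i = d →
      F (refl Φ i • μ) = F μ - (1 - t) • ∑ j ∈ Finset.range d, F (μ - j • rootWeight Φ i))
    {μ : weightLattice Φ} {d : ℕ} (hd : weightPairing μ i = (d + 2 : ℕ)) :
    F (refl Φ i • μ) = t • F μ + t • F (refl Φ i • (μ - rootWeight Φ i)) -
      F (μ - rootWeight Φ i) := by
  have hν : weightPairing (μ - rootWeight Φ i) i = d := by
    rw [weightPairing_sub_rootWeight, hd]; push_cast; ring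
  have h1 := hF μ _ hd
  have h2 := hF _ _ hν
  have e (j : ℕ) : μ - rootWeight Φ i - j • rootWeight Φ i = μ - (j + 1) • rootWeight Φ i := by
    rw [succ_nsmul]; abel
  -- The sum for `μ` is the sum for `μ - α_i` plus its two end terms, `j = 0` and `j = d + 1`; the
  -- latter is the reflected weight.
  have h3 : F (refl Φ i • (μ - rootWeight Φ i)) = F (μ - (d + 1) • rootWeight Φ i) := by
    rw [refl_smul_eq_sub_nsmul hν, e]
  rw [Finset.sum_range_succ, Finset.sum_range_succ', zero_smul, sub_zero, ← h3] at h1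
  simp_rw [e] at h2
  linear_combination (norm := module) h1 - h2

lemma straightening_formula {i : ι} {t : k} {F : weightLattice Φ → V}
    (hF : ∀ (μ : weightLattice Φ) (d : ℕ), weightPairing μ i = d →
      F (refl Φ i • μ) = F μ - (1 - t) • ∑ j ∈ Finset.range d, F (μ - j • rootWeight Φ i))
    {μ : weightLattice Φ} {d : ℕ} (hpos : 0 < d) (hd : weightPairing μ i = d) :
    F (refl Φ i • μ) = t • F μ +
      ∑ j ∈ Finset.Icc 1 ((d - 1) / 2),
        ((t ^ 2 - 1) * t ^ (j - 1)) • F (μ - j • rootWeight Φ i) +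
      if Even d then ((t - 1) * t ^ (d / 2 - 1)) • F (μ - (d / 2) • rootWeight Φ i) else 0 := by
  induction d using Nat.strong_induction_on generalizing μ with
  | _ d ih =>
    match d, hpos, hd, ih with
    | 1, _, hd, _ =>
      rw [hF μ 1 hd]
      simp [sub_smul]
    | 2, _, hd, _ =>
      have hν : weightPairing (μ - rootWeight Φ i) i = (0 : ℕ) := by
        rw [weightPairing_sub_rootWeight, hd]; rfl
      -- Here `μ - α_i` is fixed by `s_i`, so the last two terms of the recursion merge with
      -- coefficient `t - 1`.
      rw [straightening_step hF (d := 0) hd, refl_smul_eq_sub_nsmul hν]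
      simp [sub_smul, add_sub_assoc]
    | d + 3, _, hd, ih =>
      have hν : weightPairing (μ - rootWeight Φ i) i = (d + 1 : ℕ) := by
        rw [weightPairing_sub_rootWeight, hd]; push_cast; ring
      have e (j : ℕ) : μ - rootWeight Φ i - j • rootWeight Φ i =
          μ - (j + 1) • rootWeight Φ i := by
        rw [succ_nsmul]; abel
      -- The leading term `t F(μ - α_i)` of the induction hypothesis, times `t`, combines with `-F(μ
      -- - α_i)` to the new `j = 1` coefficient `t² - 1`; all other terms shift by one and gain a
      -- factor `t`.
      rw [straightening_step hF (d := d + 1) hd, ih (d + 1) (by omega) (by omega) hν,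
        sum_Icc_one_eq_sum_range, sum_Icc_one_eq_sum_range,
        show (d + 3 - 1) / 2 = (d + 1 - 1) / 2 + 1 by omega, Finset.sum_range_succ']
      simp only [e, Nat.add_sub_cancel, zero_add, one_smul, smul_add,
        Finset.smul_sum, smul_smul]
      have hsum (j : ℕ) : t * ((t ^ 2 - 1) * t ^ j) = (t ^ 2 - 1) * t ^ (j + 1) := by ring
      simp only [hsum]
      have hite : (t • if Even (d + 1) then
            ((t - 1) * t ^ ((d + 1) / 2 - 1)) • F (μ - ((d + 1) / 2 + 1) • rootWeight Φ i) else 0) =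
          if Even (d + 3) then
            ((t - 1) * t ^ ((d + 3) / 2 - 1)) • F (μ - ((d + 3) / 2) • rootWeight Φ i) else 0 := by
        have hiff : Even (d + 3) ↔ Even (d + 1) := by
          simp [Nat.even_add_one]
        by_cases he : Even (d + 1)
        · rw [if_pos he, if_pos (hiff.2 he), smul_smul]
          obtain ⟨c, hc⟩ := he
          obtain ⟨p, rfl⟩ : ∃ p, c = p + 1 := ⟨c - 1, by omega⟩
          rw [show (d + 3) / 2 = p + 2 by omega, show (d + 1) / 2 = p + 1 by omega,
            show p + 2 - 1 = p + 1 by omega, Nat.add_sub_cancel]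
          congr 1
          ring
        · rw [if_neg he, if_neg (fun h => he (hiff.1 h)), smul_zero]
      rw [hite]
      module

end Straightening

/-! ### Behaviour of `m`, `a`, `A` and `M` under a simple reflection. -/

section Families

variable {Φ : RootPairing ι ℝ M N} (b : Φ.Base)
variable [Finite ι] [Φ.IsRootSystem] [Φ.IsCrystallographic] [Φ.IsReduced]

omit [Φ.IsReduced] in
lemma mSym_smul (w : Φ.weylGroup) (μ : weightLattice Φ) : mSym Φ (w • μ) = mSym Φ μ := by
  rw [mSym, mSym]
  congr 1
  ext γ
  simp only [Set.Finite.mem_toFinset]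
  exact Set.ext_iff.mp (MulAction.orbit_eq_iff.2 (MulAction.mem_orbit μ w)) γ

/-- The substitution `w ↦ w s_i` changes the parity of every length. -/
lemma aAlt_simpleRefl_smul (i : b.support) (μ : weightLattice Φ) :
    aAlt b (simpleRefl b i • μ) = -aAlt b μ := by
  rw [aAlt, aAlt, ← Equiv.sum_comp (Equiv.mulRight (simpleRefl b i)), ← Finset.sum_neg_distrib]
  refine Finset.sum_congr rfl fun w _ => ?_
  rw [Equiv.coe_mulRight, smul_smul, mul_refl_mul_refl, ← neg_smul]
  congr 1
  by_cases h : b.IsPos (w • (i : ι))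
  · rw [len_mul_of_isPos b w i.2 h]; ring
  · rw [← len_mul_of_not_isPos b w i.2 h]; ring

lemma bigA_simpleRefl_smul (i : b.support) (μ : weightLattice Φ) :
    bigA b (simpleRefl b i • μ) = -bigA b μ := by
  set q := qLoc b
  have h1 : epsZero b (KLoc b) q *
      ((genX b (KLoc b) q μ + genX b (KLoc b) q (simpleRefl b i • μ)) * genT b (KLoc b) q i) *
      oneZero b (KLoc b) q = (q : KLoc b) • (bigA b μ + bigA b (simpleRefl b i • μ)) := by
    rw [mul_assoc, mul_assoc, genT_mul_oneZero, mul_smul_comm, mul_smul_comm, ← mul_assoc,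
      mul_add, add_mul]
    rfl
  have h2 : epsZero b (KLoc b) q *
      ((genX b (KLoc b) q μ + genX b (KLoc b) q (simpleRefl b i • μ)) * genT b (KLoc b) q i) *
      oneZero b (KLoc b) q =
        (-(↑q⁻¹ : KLoc b)) • (bigA b μ + bigA b (simpleRefl b i • μ)) := by
    rw [add_genX_mul_genT, ← mul_assoc, epsZero_mul_genT, smul_mul_assoc, smul_mul_assoc,
      mul_add, add_mul]
    rfl
  have hunit : IsUnit (1 + (q : KLoc b) ^ 2) :=
    isUnit_one_add_of_isUnit_poincare b i (isUnit_poincare_qLoc b)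
  -- `h1` lets `T_i` act on `𝟏₀`, `h2` on `ε₀`; multiplying their comparison by `q` clears `q⁻¹`.
  have h3 : (1 + (q : KLoc b) ^ 2) • (bigA b μ + bigA b (simpleRefl b i • μ)) = 0 := by
    have h4 := congrArg ((q : KLoc b) • ·) (h1.symm.trans h2)
    simp only [smul_smul, mul_neg, Units.mul_inv] at h4
    rw [add_smul, one_smul, sq (q : KLoc b), h4, neg_smul, one_smul, add_neg_cancel]
  rw [hunit.smul_eq_zero] at h3
  exact eq_neg_of_add_eq_zero_right h3

lemma bigM_simpleRefl_smul (i : b.support) (μ : weightLattice Φ) {d : ℕ}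
    (hd : weightPairing μ (i : ι) = d) :
    bigM b (simpleRefl b i • μ) = bigM b μ - (1 - tLoc b) •
      ∑ j ∈ Finset.range d, bigM b (μ - j • rootWeight Φ (i : ι)) := by
  set q := qLoc b
  have h1 : oneZero b (KLoc b) q * (genX b (KLoc b) q μ * genT b (KLoc b) q i) *
      oneZero b (KLoc b) q = (q : KLoc b) • bigM b μ := by
    rw [mul_assoc, mul_assoc, genT_mul_oneZero, mul_smul_comm, mul_smul_comm, ← mul_assoc]
    rfl
  rw [genX_mul_genT_of_weightPairing_eq b (KLoc b) q i μ hd, mul_add, ← mul_assoc,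
    oneZero_mul_genT, add_mul, smul_mul_assoc, smul_mul_assoc, mul_smul_comm, smul_mul_assoc,
    Finset.mul_sum, Finset.sum_mul] at h1
  change (q : KLoc b) • bigM b (simpleRefl b i • μ) + ((q : KLoc b) - ↑q⁻¹) •
    ∑ j ∈ Finset.range d, bigM b (μ - j • rootWeight Φ (i : ι)) = _ at h1
  -- Dividing by `q` turns `q - q⁻¹` into `1 - q⁻² = 1 - t`.
  have h2 := congrArg ((↑q⁻¹ : KLoc b) • ·) h1
  simp only [smul_smul, smul_add, Units.inv_mul, mul_sub, one_smul] at h2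
  change _ = _ - (1 - (↑q⁻¹ : KLoc b) ^ 2) • _
  rw [sq (↑q⁻¹ : KLoc b)]
  exact eq_sub_of_add_eq h2

end Families

end AffineHecke

end

theorem proposition2p5 {ι M N : Type*} [Finite ι] [AddCommGroup M] [Module ℝ M]
    [AddCommGroup N] [Module ℝ N] (Φ : RootPairing ι ℝ M N) [Φ.IsRootSystem]
    [Φ.IsCrystallographic] [Φ.IsReduced] [Φ.IsIrreducible] (b : Φ.Base) (i : b.support)
    (μ : AffineHecke.weightLattice Φ) (d : ℕ)
    (hd : Φ.toLinearMap (μ : M) (Φ.coroot i) = (d : ℝ)) :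
    AffineHecke.mSym Φ (AffineHecke.simpleRefl b i • μ) = AffineHecke.mSym Φ μ ∧
    AffineHecke.aAlt b (AffineHecke.simpleRefl b i • μ) = -AffineHecke.aAlt b μ ∧
    AffineHecke.bigA b (AffineHecke.simpleRefl b i • μ) = -AffineHecke.bigA b μ ∧
    (d = 0 → AffineHecke.bigM b μ = AffineHecke.bigM b (AffineHecke.simpleRefl b i • μ)) ∧
    (0 < d →
      AffineHecke.bigM b (AffineHecke.simpleRefl b i • μ) =
        AffineHecke.tLoc b • AffineHecke.bigM b μ +
        ∑ j ∈ Finset.Icc 1 ((d - 1) / 2),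
          ((AffineHecke.tLoc b ^ 2 - 1) * AffineHecke.tLoc b ^ (j - 1)) •
            AffineHecke.bigM b (μ - j • AffineHecke.rootWeight Φ (i : ι)) +
        if Even d then
          ((AffineHecke.tLoc b - 1) * AffineHecke.tLoc b ^ (d / 2 - 1)) •
            AffineHecke.bigM b (μ - (d / 2) • AffineHecke.rootWeight Φ (i : ι))
        else 0) := by
  have hd' : AffineHecke.weightPairing μ (i : ι) = d :=
    AffineHecke.weightPairing_eq_of_toLinearMap_eq (by exact_mod_cast hd)
  refine ⟨AffineHecke.mSym_smul _ μ, AffineHecke.aAlt_simpleRefl_smul b i μ,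
    AffineHecke.bigA_simpleRefl_smul b i μ, fun h0 => ?_, fun hpos => ?_⟩
  · subst h0
    rw [AffineHecke.bigM_simpleRefl_smul b i μ hd']
    simp
  · exact AffineHecke.straightening_formula
      (fun ν c hc => AffineHecke.bigM_simpleRefl_smul b i ν hc) hpos hd'
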